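/- A subset of a group $G$ is called rational if it belongs to the smallest family of subsets of $G$ that contains all finite subsets and is closed under the operations $L_1\cup L_2$, $L_1L_2=\{ab : a\in L_1,\ b\in L_2\}$ and $L\mapsto L^{*}$, where $L^{*}$ is the submonoid of $G$ generated by $L$. A word is an element $w=w(x_1,\dots,x_n)$ of the free group on the variables $x_1,x_2,\dots$; for a group $G$ put $w[G]=\{w(g_1,\dots,g_n) : g_1,\dots,g_n\in G\}$. The word $w$ is called proper if there are groups $G$ and $H$ with $w[G]\neq 1$ and $w[H]\neq H$. Let $e(w)\ge 0$ be the greatest common divisor of the exponent sums $t_1,\dots,t_n$ of the variables $x_1,\dots,x_n$ in $w$, with $e(w)=0$ if $t_1=\dots=t_n=0$. Theorem 5.6. Let $F$ be a free non-abelian group (of finite or infinite rank) and let $w$ be a word. Then $w$ is proper if and only if $e(w)\neq 1$ and $w\neq 1$. If $w$ is proper, then $w[F]$ is not a rational subset of $F$. Equivalently, for an arbitrary word $w$, if $w[F]$ is a rational subset of $F$, then $w[F]=1$ or $w[F]=F$. -/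

import Mathlib

open scoped Pointwise

universe u v

/-- The rational subsets of a monoid `M`: the smallest family of subsets of `M` that contains all
finite subsets and is closed under union, product, and generation of a submonoid. -/
inductive IsRationalSubset {M : Type u} [Monoid M] : Set M → Prop
  | finite (L : Set M) : L.Finite → IsRationalSubset L
  | union (L₁ L₂ : Set M) :
      IsRationalSubset L₁ → IsRationalSubset L₂ → IsRationalSubset (L₁ ∪ L₂)
  | mul (L₁ L₂ : Set M) :
      IsRationalSubset L₁ → IsRationalSubset L₂ → IsRationalSubset (L₁ * L₂)
  | star (L : Set M) :
      IsRationalSubset L → IsRationalSubset (Submonoid.closure L : Set M)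

/-- A group word: an element of the free group on the variables `x₀, x₁, x₂, …`. -/
abbrev GroupWord : Type := FreeGroup ℕ

/-- The value `w(g₀, g₁, …)` of the word `w` when the elements `g i` are substituted for the
variables. -/
def GroupWord.value {G : Type u} [Group G] (w : GroupWord) (g : ℕ → G) : G :=
  FreeGroup.lift g w

/-- The verbal set `w[G]` of all values of the word `w` in the group `G`. -/
def verbalSet (w : GroupWord) (G : Type u) [Group G] : Set G :=
  Set.range (fun g : ℕ → G => GroupWord.value w g)

/-- The word `w` is proper if `w[G] ≠ 1` for some group `G` and `w[H] ≠ H` for some group `H`. -/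
def GroupWord.IsProper (w : GroupWord) : Prop :=
  (∃ (G : Type u) (_ : Group G), verbalSet w G ≠ {1}) ∧
    ∃ (H : Type u) (_ : Group H), verbalSet w H ≠ Set.univ

/-- The total exponent of the variable `x i` in the word `w`: the value of `w` in the infinite
cyclic group `ℤ` when `1` is substituted for `x i` and `0` for every other variable. -/
def GroupWord.exponent (w : GroupWord) (i : ℕ) : ℤ :=
  Multiplicative.toAdd
    (GroupWord.value w (fun j : ℕ => Multiplicative.ofAdd (if j = i then (1 : ℤ) else 0)))

/-- The number `e(w)`: the greatest common divisor of the total exponents of the (finitely many)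
variables that occur in `w`; it is `0` if all the exponents are `0`. -/
def GroupWord.e (w : GroupWord) : ℕ :=
  (w.toWord.map Prod.fst).toFinset.gcd (fun i : ℕ => (GroupWord.exponent w i).natAbs)

/-!
# Verbal sets of proper words in free groups are not rational

A free non-abelian group maps onto the free group on two letters `a = (true, true)` and
`b = (false, true)`; surjective homomorphisms carry rational sets to rational sets and verbal sets
to verbal sets, so only this group matters. Two properties of its subsets are incompatible.

* **Verbal sets have few exceptional syllables.** For `k ≥ 1` count the maximal syllables `a ^ k`
  of a reduced word minus its maximal syllables `a ^ (-k)`. This count changes sign under inversion,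
  and for a product it is additive for all but boundedly many `k`, since after cancellation only the
  syllables at the junctions can merge. Hence on a value `w(g₁, g₂, …)` the counts agree, for all
  but boundedly many `k`, with the value of `w` in an abelian group, which is divisible by `e(w)`
  (`exists_card_forall_e_dvd_signedCount`). The bound depends only on `w`.
* **Rational conjugation-invariant sets have many.** A rational set is the image of a regular
  language (`IsRationalSubset.exists_language`). A word spelling `g` passes through every prefix of
  the reduced form of `g`, as the Cayley graph is a tree, so long powers of a letter inside the
  reduced form of an element can be pumped (`IsRationalSubset.exists_pump`). If the set contains
  `v ≠ 1`, it contains the conjugate of `v` by `(a ^ N * b) ^ K` up to small corrections; pumping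
  the first `K` syllables to distinct large exponents produces `K` values of `k` with count `1`
  (`IsRationalSubset.exists_signedCount_eq_one`).

For `e(w) ≠ 1` the number `1` is not divisible by `e(w)`, and for `w ≠ 1` the verbal set contains
some `v ≠ 1` because the free group of rank two contains the free group of infinite rank
(`exists_ne_one_mem_verbalSet`). For `e(w) = 1` a Bézout identity shows that every group element
is a value of `w`.
-/

/-! ### Regular languages and rational subsets -/

namespace Language

variable {α : Type*}

/-- A left quotient of `L * M` is determined by a left quotient of `L` and a set of left quotients
of `M`. -/
theorem finite_range_leftQuotient_mul {L M : Language α}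
    (hL : (Set.range L.leftQuotient).Finite) (hM : (Set.range M.leftQuotient).Finite) :
    (Set.range (L * M).leftQuotient).Finite := by
  refine (hL.image2 (fun (A : Language α) (B : Set (Language α)) => A * M + ⨆ C ∈ B, C)
    hM.powerset).subset ?_
  rintro _ ⟨x, rfl⟩
  refine ⟨L.leftQuotient x, ⟨x, rfl⟩,
    M.leftQuotient '' {v | ∃ u ∈ L, u ++ v = x}, Set.image_subset_range _ _, ?_⟩
  ext y
  simp only [mem_add, mem_mul, mem_leftQuotient, mem_iSup, Set.mem_image, Set.mem_ofPred_eq]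
  constructor
  · rintro (⟨a, ha, b, hb, rfl⟩ | ⟨_, ⟨v, ⟨u, hu, rfl⟩, rfl⟩, hy⟩)
    · exact ⟨x ++ a, ha, b, hb, by simp⟩
    · exact ⟨u, hu, v ++ y, hy, by simp⟩
  · rintro ⟨a, ha, b, hb, hab⟩
    rcases List.append_eq_append_iff.1 hab with ⟨c, rfl, rfl⟩ | ⟨c, rfl, rfl⟩
    · exact Or.inr ⟨_, ⟨c, ⟨a, ha, rfl⟩, rfl⟩, hb⟩
    · exact Or.inl ⟨c, ha, b, hb, rfl⟩

open scoped Computability in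
/-- Apart from `L∗` itself, a left quotient of `L∗` has the form `A * L∗`, where `A` is a union of
left quotients of `L`. -/
theorem finite_range_leftQuotient_kstar {L : Language α}
    (hL : (Set.range L.leftQuotient).Finite) :
    (Set.range L∗.leftQuotient).Finite := by
  -- A nonempty prefix of a product of words in `L` ends inside, or at the end of, a factor.
  have key : ∀ (l : List (List α)), (∀ z ∈ l, z ∈ L) → ∀ x y, x ≠ [] → l.flatten = x ++ y →
      ∃ u ∈ L∗, ∃ v, u ++ v = x ∧ y ∈ L.leftQuotient v * L∗ := by
    intro l
    induction l with
    | nil => intro _ x y hx h; simp_all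
    | cons z l ih =>
      intro hl x y hx h
      rw [List.flatten_cons] at h
      have hz : z ∈ L := hl z (by simp)
      have hl' : ∀ z ∈ l, z ∈ L := fun t ht => hl t (by simp [ht])
      rcases List.append_eq_append_iff.1 h with ⟨c, rfl, hc⟩ | ⟨c, rfl, rfl⟩
      · rcases eq_or_ne c [] with rfl | hc0
        · exact ⟨[], nil_mem_kstar _, z, by simp, mem_mul.2 ⟨[], by simpa using hz, y,
            ⟨l, by simpa using hc.symm, hl'⟩, rfl⟩⟩
        · obtain ⟨u, ⟨m, rfl, hm⟩, v, rfl, hy⟩ := ih hl' c y hc0 hc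
          exact ⟨z ++ m.flatten, ⟨z :: m, by simp, by simpa using ⟨hz, hm⟩⟩, v, by simp, hy⟩
      · exact ⟨[], nil_mem_kstar _, x, by simp, mem_mul.2 ⟨c, hz, _, ⟨l, rfl, hl'⟩, rfl⟩⟩
  refine ((hL.powerset.image
    (fun B : Set (Language α) => (⨆ C ∈ B, C) * L∗)).insert L∗).subset ?_
  rintro _ ⟨x, rfl⟩
  rcases eq_or_ne x [] with rfl | hx
  · exact Or.inl rfl
  refine Or.inr ⟨L.leftQuotient '' {v | ∃ u ∈ L∗, u ++ v = x}, Set.image_subset_range _ _, ?_⟩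
  ext y
  simp only [mem_mul, mem_leftQuotient, mem_iSup, Set.mem_image, Set.mem_ofPred_eq]
  constructor
  · rintro ⟨a, ⟨_, ⟨v, ⟨u, ⟨l, rfl, hl⟩, rfl⟩, rfl⟩, ha⟩, b, ⟨m, rfl, hm⟩, rfl⟩
    refine ⟨l ++ (v ++ a) :: m, by simp, ?_⟩
    intro t ht
    simp only [List.mem_append, List.mem_cons] at ht
    rcases ht with ht | rfl | ht
    exacts [hl _ ht, ha, hm _ ht]
  · rintro ⟨l, hl, hl'⟩
    obtain ⟨u, hu, v, rfl, hy⟩ := key l hl' x y hx hl.symm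
    obtain ⟨a, ha, b, hb, rfl⟩ := mem_mul.1 hy
    exact ⟨a, ⟨_, ⟨v, ⟨u, hu, rfl⟩, rfl⟩, ha⟩, b, hb, rfl⟩

theorem finite_range_leftQuotient_of_finite {L : Language α} (hL : Set.Finite L) :
    (Set.range L.leftQuotient).Finite := by
  have hS : Set.Finite {y : List α | ∃ z ∈ L, y <:+ z} := by
    refine (hL.biUnion (t := fun z => {y | y <:+ z}) fun z _ => ?_).subset ?_
    · exact (z.tails.finite_toSet).subset fun y hy => by simpa using hy
    · rintro y ⟨z, hz, hy⟩
      exact Set.mem_biUnion hz hy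
  refine hS.powerset.subset ?_
  rintro _ ⟨x, rfl⟩ y hy
  exact ⟨x ++ y, hy, List.suffix_append _ _⟩

end Language

open scoped Computability in
/-- Every rational subset of a free group is the image of a regular language over the letters and
their inverses. Regularity is expressed through the finiteness of the set of left quotients
(Myhill–Nerode). -/
theorem IsRationalSubset.exists_language {α : Type u} {R : Set (FreeGroup α)}
    (hR : IsRationalSubset R) :
    ∃ L : Language (α × Bool), (Set.range L.leftQuotient).Finite ∧
      ∀ g, g ∈ R ↔ ∃ W ∈ L, FreeGroup.mk W = g := by
  classical
  induction hR with
  | finite R hR =>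
    refine ⟨(FreeGroup.toWord '' R : Set _),
      Language.finite_range_leftQuotient_of_finite (hR.image _), fun g => ?_⟩
    constructor
    · exact fun hg => ⟨g.toWord, ⟨g, hg, rfl⟩, FreeGroup.mk_toWord⟩
    · rintro ⟨_, ⟨h, hh, rfl⟩, rfl⟩
      rwa [FreeGroup.mk_toWord]
  | union R S _ _ ihR ihS =>
    obtain ⟨L, hL, hLR⟩ := ihR
    obtain ⟨M, hM, hMS⟩ := ihS
    refine ⟨L + M, ((Language.IsRegular.of_finite_range_leftQuotient hL).add
      (.of_finite_range_leftQuotient hM)).finite_range_leftQuotient, fun g => ?_⟩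
    simp only [Set.mem_union, hLR, hMS, Language.mem_add, or_and_right, exists_or]
  | mul R S _ _ ihR ihS =>
    obtain ⟨L, hL, hLR⟩ := ihR
    obtain ⟨M, hM, hMS⟩ := ihS
    refine ⟨L * M, Language.finite_range_leftQuotient_mul hL hM, fun g => ?_⟩
    constructor
    · rintro ⟨a, ha, b, hb, rfl⟩
      obtain ⟨U, hU, rfl⟩ := (hLR a).1 ha
      obtain ⟨V, hV, rfl⟩ := (hMS b).1 hb
      exact ⟨U ++ V, Language.append_mem_mul hU hV, FreeGroup.mul_mk.symm⟩
    · rintro ⟨_, ⟨U, hU, V, hV, rfl⟩, rfl⟩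
      exact ⟨_, (hLR _).2 ⟨U, hU, rfl⟩, _, (hMS _).2 ⟨V, hV, rfl⟩, FreeGroup.mul_mk⟩
  | star R _ ih =>
    obtain ⟨L, hL, hLR⟩ := ih
    refine ⟨L∗, Language.finite_range_leftQuotient_kstar hL, fun g => ?_⟩
    constructor
    · intro hg
      induction hg using Submonoid.closure_induction with
      | mem x hx =>
        obtain ⟨W, hW, rfl⟩ := (hLR x).1 hx
        exact ⟨W, ⟨[W], by simp, by simpa using hW⟩, rfl⟩
      | one => exact ⟨[], Language.nil_mem_kstar _, FreeGroup.one_eq_mk.symm⟩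
      | mul x y _ _ ihx ihy =>
        obtain ⟨_, ⟨U, rfl, hU⟩, rfl⟩ := ihx
        obtain ⟨_, ⟨V, rfl, hV⟩, rfl⟩ := ihy
        refine ⟨_, ⟨U ++ V, rfl, fun t ht => ?_⟩, by simp [FreeGroup.mul_mk]⟩
        exact (List.mem_append.1 ht).elim (hU t) (hV t)
    · rintro ⟨_, ⟨l, rfl, hl⟩, rfl⟩
      induction l with
      | nil => exact one_mem (Submonoid.closure R)
      | cons z l ih =>
        rw [List.flatten_cons, ← FreeGroup.mul_mk]
        exact mul_mem (Submonoid.subset_closure ((hLR _).2 ⟨z, hl z (by simp), rfl⟩))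
          (ih fun t ht => hl t (by simp [ht]))

/-! ### Pumping in rational subsets of free groups -/

namespace FreeGroup

variable {α : Type u}

/-- A path in the Cayley tree passes through every vertex of the geodesic joining its ends: if `U`
is a prefix of the reduced form of `W`, then some prefix of `W` spells the same element as `U`. -/
theorem exists_append_eq_of_reduce_eq_append [DecidableEq α] {W U V : List (α × Bool)}
    (h : reduce W = U ++ V) :
    ∃ W₁ W₂, W = W₁ ++ W₂ ∧ mk W₁ = mk U := by
  induction W generalizing U with
  | nil =>
    have h' : [] = U ++ V := h
    obtain ⟨rfl, rfl⟩ := List.nil_eq_append_iff.1 h'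
    exact ⟨[], [], rfl, rfl⟩
  | cons l W ih =>
    rcases U with _ | ⟨u, U⟩
    · exact ⟨[], l :: W, rfl, rfl⟩
    have cancel : reduce W = (l.1, !l.2) :: (u :: U ++ V) →
        ∃ W₁ W₂, l :: W = W₁ ++ W₂ ∧ mk W₁ = mk (u :: U) := by
      intro hr
      obtain ⟨W₁, W₂, rfl, hW⟩ := ih (U := (l.1, !l.2) :: u :: U) hr
      refine ⟨l :: W₁, W₂, rfl, ?_⟩
      change mk ([l] ++ W₁) = _
      rw [← mul_mk, hW, mul_mk]
      exact Quot.sound (Red.Step.not (L₁ := []))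
    rw [reduce.cons] at h
    rcases hr : reduce W with _ | ⟨hd, tl⟩
    · rw [hr] at h
      simp only [List.cons_append, List.cons.injEq] at h
      obtain ⟨rfl, h⟩ := h
      obtain ⟨rfl, rfl⟩ := List.nil_eq_append_iff.1 h
      exact ⟨[l], W, rfl, rfl⟩
    · rw [hr] at h
      dsimp only at h
      split_ifs at h with hc
      · refine cancel ?_
        rw [hr, ← h]
        simp [hc.1, hc.2]
      · simp only [List.cons_append, List.cons.injEq] at h
        obtain ⟨rfl, h⟩ := h
        obtain ⟨W₁, W₂, rfl, hW⟩ := ih (U := U) (hr.trans h)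
        refine ⟨l :: W₁, W₂, rfl, ?_⟩
        change mk ([l] ++ W₁) = mk ([l] ++ U)
        rw [← mul_mk, hW, mul_mk]

theorem exists_append_eq_of_mk_eq {W U V : List (α × Bool)}
    (hUV : IsReduced (U ++ V)) (h : mk W = mk (U ++ V)) :
    ∃ W₁ W₂, W = W₁ ++ W₂ ∧ mk W₁ = mk U ∧ mk W₂ = mk V := by
  classical
  obtain ⟨W₁, W₂, rfl, hW⟩ := exists_append_eq_of_reduce_eq_append
    ((reduce.sound h).trans hUV.reduce_eq)
  refine ⟨W₁, W₂, rfl, hW, ?_⟩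
  rw [← mul_mk, ← mul_mk, hW] at h
  exact mul_left_cancel h

theorem mk_flatten_eq_pow {l : List (List (α × Bool))} {c : α × Bool}
    (h : ∀ W ∈ l, mk W = mk [c]) : mk l.flatten = mk [c] ^ l.length := by
  induction l with
  | nil => rfl
  | cons W l ih =>
    rw [List.flatten_cons, ← mul_mk, h W (by simp), ih fun V hV => h V (by simp [hV]),
      List.length_cons, pow_succ']

theorem mk_replicate (n : ℕ) (c : α × Bool) : mk (List.replicate n c) = mk [c] ^ n := by
  induction n with
  | zero => rfl
  | succ n ih =>
    rw [pow_succ', ← ih, mul_mk]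
    rfl

theorem exists_flatten_of_mk_eq_replicate_append {n : ℕ} {c : α × Bool} {W V : List (α × Bool)}
    (hV : IsReduced (List.replicate n c ++ V)) (h : mk W = mk (List.replicate n c ++ V)) :
    ∃ (l : List (List (α × Bool))) (W' : List (α × Bool)), W = l.flatten ++ W' ∧ l.length = n ∧
      (∀ X ∈ l, mk X = mk [c]) ∧ mk W' = mk V := by
  induction n generalizing W with
  | zero => exact ⟨[], W, rfl, rfl, by simp, h⟩
  | succ n ih =>
    obtain ⟨X, W', rfl, hX, hW'⟩ := exists_append_eq_of_mk_eq (U := [c]) hV h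
    obtain ⟨l, W'', rfl, rfl, hl, hW''⟩ := ih (hV.infix ⟨[c], [], by simp; rfl⟩) hW'
    exact ⟨X :: l, W'', by simp, rfl, by simpa using ⟨hX, hl⟩, hW''⟩

end FreeGroup

theorem Language.leftQuotient_append_flatten_replicate {α : Type*} {L : Language α}
    {P X : List α} (h : L.leftQuotient (P ++ X) = L.leftQuotient P) (j : ℕ) :
    L.leftQuotient (P ++ (List.replicate j X).flatten) = L.leftQuotient P := by
  induction j with
  | zero => simp
  | succ j ih =>
    rw [List.replicate_succ, List.flatten_cons, ← List.append_assoc, leftQuotient_append, h,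
      ← leftQuotient_append, ih]

/-- Pumping lemma: if the reduced form of an element of a rational set has a sufficiently long
power of a letter `c` as a factor, this power can be lengthened by the multiples of some `p > 0`
without leaving the set. -/
theorem IsRationalSubset.exists_pump {α : Type u} {R : Set (FreeGroup α)}
    (hR : IsRationalSubset R) :
    ∃ N : ℕ, ∀ (U V : List (α × Bool)) (c : α × Bool),
      FreeGroup.IsReduced (U ++ (List.replicate N c ++ V)) →
      FreeGroup.mk (U ++ (List.replicate N c ++ V)) ∈ R →
      ∃ p, 0 < p ∧ ∀ j, FreeGroup.mk (U ++ (List.replicate (N + p * j) c ++ V)) ∈ R := by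
  obtain ⟨L, hL, hLR⟩ := hR.exists_language
  refine ⟨hL.toFinset.card, fun U V c hred hmem => ?_⟩
  set N := hL.toFinset.card
  obtain ⟨W, hW, hWg⟩ := (hLR _).1 hmem
  obtain ⟨W₀, W', rfl, hW₀, hW'⟩ := FreeGroup.exists_append_eq_of_mk_eq hred hWg
  obtain ⟨l, W₁, rfl, hl, hlc, hW₁⟩ := FreeGroup.exists_flatten_of_mk_eq_replicate_append
    (hred.infix ⟨U, [], by simp⟩) hW'
  -- Among the `N + 1` prefixes of the spelling that end at a vertex of the segment `c ^ N`, two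
  -- have the same left quotient; the piece `X` between them spells a positive power of `c`.
  obtain ⟨i, hi, j, hj, hij, heq⟩ : ∃ i ∈ Finset.range (N + 1), ∃ j ∈ Finset.range (N + 1),
      i < j ∧ L.leftQuotient (W₀ ++ (l.take i).flatten) =
        L.leftQuotient (W₀ ++ (l.take j).flatten) := by
    obtain ⟨i, hi, j, hj, hij, heq⟩ := Finset.exists_ne_map_eq_of_card_lt_of_maps_to
      (s := Finset.range (N + 1)) (t := hL.toFinset) (by simp [N])
      (f := fun i => L.leftQuotient (W₀ ++ (l.take i).flatten)) (fun i _ => by simp)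
    rcases lt_or_gt_of_ne hij with h | h
    exacts [⟨i, hi, j, hj, h, heq⟩, ⟨j, hj, i, hi, h, heq.symm⟩]
  have hjN : j ≤ N := Nat.lt_succ_iff.1 (Finset.mem_range.1 hj)
  set X := ((l.take j).drop i).flatten with hX
  have hP : (l.take j).flatten = (l.take i).flatten ++ X := by
    rw [hX, ← List.flatten_append]
    conv_lhs => rw [← List.take_append_drop i (l.take j), List.take_take, min_eq_left hij.le]
  have hXc : FreeGroup.mk X = FreeGroup.mk [c] ^ (j - i) := by
    rw [hX, FreeGroup.mk_flatten_eq_pow]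
    · congr 1
      simp [hl, hjN]
    · exact fun Y hY => hlc Y (List.mem_of_mem_take (List.mem_of_mem_drop hY))
  refine ⟨j - i, Nat.sub_pos_of_lt hij, fun t => (hLR _).2
    ⟨W₀ ++ (l.take i).flatten ++ (List.replicate t X).flatten ++ (X ++ (l.drop j).flatten ++ W₁),
      ?_, ?_⟩⟩
  · rw [← Language.mem_leftQuotient, Language.leftQuotient_append_flatten_replicate,
      Language.mem_leftQuotient]
    · convert hW using 1
      conv_rhs => rw [← List.take_append_drop j l, List.flatten_append, hP]
      simp
    · rw [heq, hP, List.append_assoc]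
  · have h1 : FreeGroup.mk (l.take i).flatten = FreeGroup.mk [c] ^ i := by
      rw [FreeGroup.mk_flatten_eq_pow fun Y hY => hlc Y (List.mem_of_mem_take hY)]
      congr 1
      simp only [List.length_take, hl]
      omega
    have h2 : FreeGroup.mk (l.drop j).flatten = FreeGroup.mk [c] ^ (N - j) := by
      rw [FreeGroup.mk_flatten_eq_pow fun Y hY => hlc Y (List.mem_of_mem_drop hY)]
      simp [hl]
    have h3 : FreeGroup.mk (List.replicate t X).flatten = FreeGroup.mk [c] ^ ((j - i) * t) := by
      rw [pow_mul, ← hXc]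
      clear_value X
      induction t with
      | zero => rfl
      | succ t ih =>
        rw [List.replicate_succ, List.flatten_cons, ← FreeGroup.mul_mk, ih, pow_succ']
    simp only [← FreeGroup.mul_mk, FreeGroup.mk_replicate, h1, h2, h3, hXc, hW₀, hW₁,
      mul_assoc, mul_right_inj]
    simp only [← mul_assoc, ← pow_add, mul_left_inj]
    congr 1
    generalize (j - i) * t = q
    omega

/-! ### Counting syllables -/

/-- Two integer sequences agree outside a set of at most `C` indices. -/
def EqOffCard (C : ℕ) (f g : ℕ → ℤ) : Prop :=
  ∃ T : Finset ℕ, T.card ≤ C ∧ ∀ k ∉ T, f k = g k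

namespace EqOffCard

variable {C D : ℕ} {f g h f' g' : ℕ → ℤ}

theorem refl (f : ℕ → ℤ) : EqOffCard 0 f f := ⟨∅, by simp⟩

theorem symm : EqOffCard C f g → EqOffCard C g f
  | ⟨T, hT, h⟩ => ⟨T, hT, fun k hk => (h k hk).symm⟩

theorem trans (hfg : EqOffCard C f g) (hgh : EqOffCard D g h) : EqOffCard (C + D) f h := by
  obtain ⟨S, hS, hS'⟩ := hfg
  obtain ⟨T, hT, hT'⟩ := hgh
  refine ⟨S ∪ T, (Finset.card_union_le S T).trans (by omega), fun k hk => ?_⟩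
  rw [Finset.mem_union, not_or] at hk
  exact (hS' k hk.1).trans (hT' k hk.2)

theorem add (hfg : EqOffCard C f g) (hfg' : EqOffCard D f' g') :
    EqOffCard (C + D) (f + f') (g + g') := by
  obtain ⟨S, hS, hS'⟩ := hfg
  obtain ⟨T, hT, hT'⟩ := hfg'
  refine ⟨S ∪ T, (Finset.card_union_le S T).trans (by omega), fun k hk => ?_⟩
  rw [Finset.mem_union, not_or] at hk
  rw [Pi.add_apply, Pi.add_apply, hS' k hk.1, hT' k hk.2]

theorem neg (hfg : EqOffCard C f g) : EqOffCard C (-f) (-g) := by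
  obtain ⟨S, hS, hS'⟩ := hfg
  exact ⟨S, hS, fun k hk => by rw [Pi.neg_apply, Pi.neg_apply, hS' k hk]⟩

end EqOffCard

/-- For a word in the letters `a = (true, true)`, `b = (false, true)` and their inverses,
`syllableCount l n k` is the number of maximal blocks of letters `a⁻¹`, `a` with exponent sum
`k + 1` in the word `a ^ n * l`. -/
def syllableCount : List (Bool × Bool) → ℤ → ℕ → ℤ
  | [], n, k => if n = k + 1 then 1 else 0
  | (true, e) :: l, n, k => syllableCount l (n + if e then 1 else -1) k
  | (false, _) :: l, n, k => (if n = k + 1 then 1 else 0) + syllableCount l 0 k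

/-- Here `y` is the exponent of the (possibly trivial) power of `a` with which `l` begins: a power
of `a` put in front of `l` changes only this syllable. -/
theorem exists_syllableCount_shift (l : List (Bool × Bool)) :
    ∃ y : ℤ, ∀ n k, syllableCount l n k + (if y = k + 1 then 1 else 0) =
      (if n + y = k + 1 then 1 else 0) + syllableCount l 0 k := by
  induction l with
  | nil => exact ⟨0, fun n k => by simp [syllableCount]⟩
  | cons c l ih =>
    obtain ⟨c | c, e⟩ := c
    · refine ⟨0, fun n k => ?_⟩
      simp only [syllableCount, add_zero]
      ring
    · obtain ⟨y, hy⟩ := ih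
      refine ⟨(if e then 1 else -1) + y, fun n k => ?_⟩
      have h1 := hy (n + if e then 1 else -1) k
      have h2 := hy (if e then 1 else -1) k
      rw [add_assoc] at h1
      simp only [syllableCount, zero_add]
      linarith

/-- Here `x` and `y` are the exponents of the last syllable of `l₁` and the first one of `l₂`, which
merge in `l₁ ++ l₂`. -/
theorem exists_syllableCount_append (l₁ l₂ : List (Bool × Bool)) :
    ∃ x y : ℤ, ∀ k, syllableCount (l₁ ++ l₂) 0 k +
      ((if x = k + 1 then 1 else 0) + (if y = k + 1 then 1 else 0)) =
      syllableCount l₁ 0 k + syllableCount l₂ 0 k + (if x + y = k + 1 then 1 else 0) := by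
  obtain ⟨y, hy⟩ := exists_syllableCount_shift l₂
  suffices ∀ n, ∃ x : ℤ, ∀ k, syllableCount (l₁ ++ l₂) n k +
      ((if x = k + 1 then 1 else 0) + (if y = k + 1 then 1 else 0)) =
      syllableCount l₁ n k + syllableCount l₂ 0 k + (if x + y = k + 1 then 1 else 0) from
    let ⟨x, hx⟩ := this 0
    ⟨x, y, hx⟩
  induction l₁ with
  | nil =>
    intro n
    refine ⟨n, fun k => ?_⟩
    have := hy n k
    simp only [List.nil_append, syllableCount]
    linarith
  | cons c l ih =>
    intro n
    obtain ⟨c | c, e⟩ := c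
    · obtain ⟨x, hx⟩ := ih 0
      refine ⟨x, fun k => ?_⟩
      have := hx k
      simp only [List.cons_append, syllableCount]
      linarith
    · exact ih _

theorem syllableCount_append_eqOffCard (l₁ l₂ : List (Bool × Bool)) :
    EqOffCard 3 (syllableCount (l₁ ++ l₂) 0) (syllableCount l₁ 0 + syllableCount l₂ 0) := by
  obtain ⟨x, y, h⟩ := exists_syllableCount_append l₁ l₂
  refine ⟨({x, y, x + y} : Finset ℤ).image fun z => (z - 1).toNat,
    Finset.card_image_le.trans Finset.card_le_three, fun k hk => ?_⟩
  have hne : ∀ z ∈ ({x, y, x + y} : Finset ℤ), z ≠ k + 1 := by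
    rintro z hz rfl
    exact hk (Finset.mem_image.2 ⟨_, hz, by simp⟩)
  have := h k
  rw [if_neg (hne x (by simp)), if_neg (hne y (by simp)), if_neg (hne (x + y) (by simp))] at this
  simpa using this

open FreeGroup in
/-- The number of syllables `a ^ (k + 1)` minus the number of syllables `a ^ (-(k + 1))`, as a
function of `k`. -/
def signedCount (l : List (Bool × Bool)) : ℕ → ℤ :=
  syllableCount l 0 - syllableCount (invRev l) 0

theorem signedCount_invRev (l : List (Bool × Bool)) :
    signedCount (FreeGroup.invRev l) = -signedCount l := by
  simp [signedCount]

theorem signedCount_append_eqOffCard (l₁ l₂ : List (Bool × Bool)) :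
    EqOffCard 6 (signedCount (l₁ ++ l₂)) (signedCount l₁ + signedCount l₂) := by
  have h := (syllableCount_append_eqOffCard l₁ l₂).add
    (syllableCount_append_eqOffCard (FreeGroup.invRev l₂) (FreeGroup.invRev l₁)).neg
  convert h using 1
  · simp [signedCount, FreeGroup.invRev, sub_eq_add_neg]
  · simp only [signedCount]
    abel

namespace FreeGroup

/-- The product of two reduced words is obtained by cancelling a suffix `c` of the first word with
the prefix `c⁻¹` of the second one. -/
theorem exists_cancellation {α : Type*} [DecidableEq α] (l₁ l₂ : List (α × Bool))
    (h₁ : IsReduced l₁) (h₂ : IsReduced l₂) :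
    ∃ u c v, l₁ = u ++ c ∧ l₂ = invRev c ++ v ∧ reduce (l₁ ++ l₂) = u ++ v := by
  induction l₁ using List.reverseRecOn generalizing l₂ with
  | nil => exact ⟨[], [], l₂, rfl, rfl, h₂.reduce_eq⟩
  | append_singleton l x ih =>
    rcases l₂ with _ | ⟨y, l₂⟩
    · exact ⟨l ++ [x], [], [], by simp, rfl, by simpa using h₁.reduce_eq⟩
    by_cases hxy : x.1 = y.1 → x.2 = y.2
    · refine ⟨l ++ [x], [], y :: l₂, by simp, rfl, IsReduced.reduce_eq ?_⟩
      exact IsReduced.append_overlap (L₃ := y :: l₂) h₁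
        (by exact isReduced_cons_cons.2 ⟨hxy, h₂⟩) (by simp)
    · obtain ⟨u, c, v, rfl, rfl, h⟩ := ih l₂ (h₁.infix ⟨[], [x], by simp⟩)
        (h₂.infix ⟨[y], [], by simp⟩)
      push Not at hxy
      have hy : y = (x.1, !x.2) := by
        refine Prod.ext hxy.1.symm ?_
        have := hxy.2
        revert this
        cases x.2 <;> cases y.2 <;> simp
      refine ⟨u, c ++ [x], v, by simp, by simp [invRev, hy], ?_⟩
      rw [← h]
      refine reduce.Step.eq ?_
      rw [hy]
      simpa using Red.Step.not (L₁ := u ++ c) (L₂ := invRev c ++ v) (x := x.1) (b := x.2)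

end FreeGroup

/-- The cancelled parts `c` and `c⁻¹` contribute opposite counts, so only the three junctions in
`u * v`, `u * c` and `c⁻¹ * v` matter. -/
theorem signedCount_toWord_mul (g h : FreeGroup Bool) :
    EqOffCard 18 (signedCount (g * h).toWord)
      (signedCount g.toWord + signedCount h.toWord) := by
  obtain ⟨u, c, v, hg, hh, hgh⟩ := FreeGroup.exists_cancellation g.toWord h.toWord
    FreeGroup.isReduced_toWord FreeGroup.isReduced_toWord
  rw [FreeGroup.toWord_mul, hgh, hg, hh]
  have h := (signedCount_append_eqOffCard u v).trans (D := 12)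
    (h := signedCount (u ++ c) + signedCount (FreeGroup.invRev c ++ v)) ?_
  · exact h
  · convert ((signedCount_append_eqOffCard u c).add
      (signedCount_append_eqOffCard (FreeGroup.invRev c) v)).symm using 1
    rw [signedCount_invRev]
    abel

/-! ### Values of a word in abelian groups and syllable counts of values -/

/-- The signed counts of a value of `w` agree, for all but boundedly many indices, with the value of
`w` at the signed counts of the arguments in the abelian group `ℕ → ℤ`. -/
theorem signedCount_value (w : GroupWord) :
    ∃ C, ∀ g : ℕ → FreeGroup Bool, EqOffCard C (signedCount (w.value g).toWord)
      (w.value fun i => Multiplicative.ofAdd (signedCount (g i).toWord)).toAdd := by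
  unfold GroupWord.value
  induction w using FreeGroup.induction_on with
  | C1 =>
    refine ⟨0, fun g => ?_⟩
    convert EqOffCard.refl 0 using 1
    · simp [signedCount]
    · exact congrArg Multiplicative.toAdd (map_one _)
  | of i => exact ⟨0, fun g => by simpa using EqOffCard.refl _⟩
  | inv_of i _ =>
    refine ⟨0, fun g => ?_⟩
    simpa [FreeGroup.toWord_inv, signedCount_invRev] using EqOffCard.refl _
  | mul x y hx hy =>
    obtain ⟨C, hC⟩ := hx
    obtain ⟨D, hD⟩ := hy
    refine ⟨18 + (C + D), fun g => ?_⟩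
    simp only [map_mul, toAdd_mul]
    exact (signedCount_toWord_mul _ _).trans ((hC g).add (hD g))

theorem GroupWord.value_mk_cons {G : Type*} [Group G] (c : ℕ × Bool) (l : List (ℕ × Bool))
    (g : ℕ → G) : GroupWord.value (FreeGroup.mk (c :: l)) g =
      (if c.2 then g c.1 else (g c.1)⁻¹) * GroupWord.value (FreeGroup.mk l) g := by
  have hc : (FreeGroup.mk (c :: l) : GroupWord) =
      FreeGroup.mk [c] * FreeGroup.mk l := (FreeGroup.mul_mk (L₁ := [c])).symm
  rw [hc, GroupWord.value, map_mul]
  congr 1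
  simp [cond_eq_ite]

theorem GroupWord.value_eq_prod {A : Type*} [CommGroup A] (w : GroupWord) (g : ℕ → A) :
    w.value g = ∏ i ∈ (w.toWord.map Prod.fst).toFinset, g i ^ w.exponent i := by
  suffices ∀ (l : List (ℕ × Bool)) (S : Finset ℕ), (∀ c ∈ l, c.1 ∈ S) →
      GroupWord.value (FreeGroup.mk l) g =
        ∏ i ∈ S, g i ^ GroupWord.exponent (FreeGroup.mk l) i by
    have h := this w.toWord (w.toWord.map Prod.fst).toFinset
      fun c hc => List.mem_toFinset.2 (List.mem_map_of_mem hc)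
    rwa [FreeGroup.mk_toWord] at h
  intro l S
  induction l with
  | nil =>
    intro _
    simp [GroupWord.value, GroupWord.exponent, ← FreeGroup.one_eq_mk]
  | cons c l ih =>
    intro hl
    have he : ∀ i, GroupWord.exponent (FreeGroup.mk (c :: l)) i =
        (if c.1 = i then (if c.2 then 1 else -1) else 0) +
          GroupWord.exponent (FreeGroup.mk l) i := by
      intro i
      have := congrArg Multiplicative.toAdd
        (GroupWord.value_mk_cons c l
          fun j : ℕ => Multiplicative.ofAdd (if j = i then (1 : ℤ) else 0))
      rw [GroupWord.exponent, this, toAdd_mul]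
      congr 1
      split_ifs <;> simp
    rw [GroupWord.value_mk_cons, ih fun d hd => hl d (by simp [hd])]
    simp only [he, zpow_add, Finset.prod_mul_distrib]
    congr 1
    rw [Finset.prod_eq_single_of_mem c.1 (hl c (by simp))]
    · rw [if_pos rfl]
      split_ifs <;> simp
    · intro i _ hi
      simp [hi.symm]

theorem GroupWord.exists_value_eq_pow {A : Type*} [CommGroup A] (w : GroupWord) (g : ℕ → A) :
    ∃ x, w.value g = x ^ w.e := by
  have hd : ∀ i ∈ (w.toWord.map Prod.fst).toFinset, (w.e : ℤ) ∣ w.exponent i :=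
    fun i hi => Int.natCast_dvd.2 (Finset.gcd_dvd hi)
  refine ⟨∏ i ∈ (w.toWord.map Prod.fst).toFinset, g i ^ (w.exponent i / w.e), ?_⟩
  rw [w.value_eq_prod, ← Finset.prod_pow]
  refine Finset.prod_congr rfl fun i hi => ?_
  rw [← zpow_natCast, ← zpow_mul, Int.ediv_mul_cancel (hd i hi)]

/-- On the verbal set of `w`, all but a bounded number of the signed syllable counts are divisible
by `e(w)`. -/
theorem exists_card_forall_e_dvd_signedCount (w : GroupWord) :
    ∃ C, ∀ x ∈ verbalSet w (FreeGroup Bool), ∃ T : Finset ℕ, T.card ≤ C ∧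
      ∀ k ∉ T, (w.e : ℤ) ∣ signedCount x.toWord k := by
  obtain ⟨C, hC⟩ := signedCount_value w
  refine ⟨C, ?_⟩
  rintro _ ⟨g, rfl⟩
  obtain ⟨T, hT, h⟩ := hC g
  refine ⟨T, hT, fun k hk => ?_⟩
  obtain ⟨x, hx⟩ := w.exists_value_eq_pow
    fun i => Multiplicative.ofAdd (signedCount (g i).toWord)
  refine ⟨x.toAdd k, (h k hk).trans ?_⟩
  rw [hx, toAdd_pow]
  simp

/-! ### Conjugation-invariant rational subsets -/

namespace FreeGroup

theorem IsReduced.invRev {α : Type*} {l : List (α × Bool)} (h : IsReduced l) :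
    IsReduced (invRev l) := by
  classical
  rw [isReduced_iff_reduce_eq, reduce_invRev, h.reduce_eq]

theorem isReduced_append {α : Type*} {l₁ l₂ : List (α × Bool)} :
    IsReduced (l₁ ++ l₂) ↔ IsReduced l₁ ∧ IsReduced l₂ ∧
      ∀ x ∈ l₁.getLast?, ∀ y ∈ l₂.head?, x.1 = y.1 → x.2 = y.2 :=
  List.isChain_append

theorem head?_invRev {α : Type*} (l : List (α × Bool)) :
    (invRev l).head? = l.getLast?.map fun x => (x.1, !x.2) := by
  simp [FreeGroup.invRev]

end FreeGroup

/-- The word `a ^ (k₁ + 1) * b * ⋯ * a ^ (kₙ + 1) * b`, where `a = (true, true)` and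
`b = (false, true)`. -/
def blockWord (ks : List ℕ) : List (Bool × Bool) :=
  ks.flatMap fun k => List.replicate (k + 1) (true, true) ++ [(false, true)]

theorem blockWord_cons (k : ℕ) (ks : List ℕ) :
    blockWord (k :: ks) =
      List.replicate (k + 1) (true, true) ++ (false, true) :: blockWord ks := by
  simp [blockWord]

theorem blockWord_append (ks ms : List ℕ) :
    blockWord (ks ++ ms) = blockWord ks ++ blockWord ms := by
  simp [blockWord]

theorem blockWord_cons_append_eq (k : ℕ) (ks : List ℕ) (V : List (Bool × Bool)) :
    blockWord (k :: ks) ++ V =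
      List.replicate k (true, true) ++ (true, true) :: (false, true) :: (blockWord ks ++ V) := by
  simp [blockWord_cons, List.replicate_succ']

theorem isReduced_blockWord_append {V : List (Bool × Bool)} (hV : FreeGroup.IsReduced V)
    (hV' : (false, false) ∉ V.head?) (ks : List ℕ) :
    FreeGroup.IsReduced (blockWord ks ++ V) := by
  suffices FreeGroup.IsReduced (blockWord ks ++ V) ∧
    (false, false) ∉ (blockWord ks ++ V).head? from this.1
  induction ks with
  | nil => exact ⟨hV, hV'⟩
  | cons k ks ih =>
    refine ⟨?_, by simp [blockWord_cons, List.replicate_succ]⟩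
    rw [blockWord_cons, List.append_assoc, FreeGroup.isReduced_append]
    refine ⟨List.isChain_replicate_of_rel _ fun _ => rfl, ?_, ?_⟩
    · rw [List.cons_append, ← List.singleton_append, FreeGroup.isReduced_append]
      refine ⟨FreeGroup.IsReduced.singleton, ih.1, ?_⟩
      rintro x hx ⟨y, e⟩ hy
      simp only [List.getLast?_singleton, Option.mem_def, Option.some.injEq] at hx
      subst hx
      rintro rfl
      cases e
      · exact absurd hy ih.2
      · rfl
    · simp [List.getLast?_replicate]

theorem syllableCount_replicate_append (m : ℕ) (l : List (Bool × Bool)) (n : ℤ) (k : ℕ) :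
    syllableCount (List.replicate m (true, true) ++ l) n k = syllableCount l (n + m) k := by
  induction m generalizing n with
  | zero => simp
  | succ m ih =>
    rw [List.replicate_succ, List.cons_append, syllableCount, ih]
    congr 1
    push_cast
    simp only [if_true]
    ring

theorem syllableCount_blockWord_append (ks : List ℕ) (V : List (Bool × Bool)) (k : ℕ) :
    syllableCount (blockWord ks ++ V) 0 k = ks.count k + syllableCount V 0 k := by
  induction ks with
  | nil => simp [blockWord]
  | cons m ks ih =>
    rw [blockWord_cons, List.append_assoc, syllableCount_replicate_append, List.cons_append,
      syllableCount, ih, List.count_cons]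
    by_cases h : m = k <;> simp [h]
    ring

theorem syllableCount_eq_zero {l : List (Bool × Bool)} {n : ℤ} {k : ℕ}
    (h : n + l.count (true, true) ≤ k) (h' : l.count (true, true) ≤ k) :
    syllableCount l n k = 0 := by
  induction l generalizing n with
  | nil =>
    rw [syllableCount, if_neg]
    simp at h
    omega
  | cons c l ih =>
    obtain ⟨_ | _, _ | _⟩ := c <;> simp only [List.count_cons, syllableCount] at h h' ⊢ <;>
      simp at h h' ⊢
    · rw [ih (by omega) h', if_neg (by omega), add_zero]
    · rw [ih (by omega) h', if_neg (by omega), add_zero]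
    · exact ih (by omega) h'
    · exact ih (by omega) (by omega)

theorem count_invRev (l : List (Bool × Bool)) :
    (FreeGroup.invRev l).count (true, true) = l.count (true, false) := by
  induction l with
  | nil => rfl
  | cons c l ih =>
    rw [FreeGroup.invRev_cons, List.count_append, ih, List.count_cons]
    congr 1
    obtain ⟨_ | _, _ | _⟩ := c <;> rfl

/-- Syllables with exponents larger than `V.length` do not occur in `V`, and all syllables of the
block word have positive exponents. -/
theorem signedCount_blockWord_append (ks : List ℕ) (V : List (Bool × Bool)) {k : ℕ}
    (hk : V.length ≤ k) : signedCount (blockWord ks ++ V) k = ks.count k := by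
  have h1 : V.count (true, true) ≤ V.length := List.count_le_length
  have h2 : (FreeGroup.invRev (blockWord ks ++ V)).count (true, true) ≤ V.length := by
    rw [count_invRev, List.count_append, List.count_eq_zero_of_not_mem, zero_add]
    · exact List.count_le_length
    · simp [blockWord, List.mem_flatMap, List.mem_replicate]
  rw [signedCount, Pi.sub_apply, syllableCount_blockWord_append,
    syllableCount_eq_zero (l := V) (by omega) (by omega),
    syllableCount_eq_zero (by omega) (by omega)]
  simp

/-- A nontrivial element is conjugate, by `1`, `a` or `a⁻¹`, to a reduced word that neither begins
with `b⁻¹` nor ends with `b`; conjugation by a word ending with `b` then causes no cancellation. -/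
theorem FreeGroup.exists_conj_ends {g : FreeGroup Bool} (hg : g ≠ 1) :
    ∃ (h : FreeGroup Bool) (l : List (Bool × Bool)), IsReduced l ∧ l ≠ [] ∧
      (false, false) ∉ l.head? ∧ (false, true) ∉ l.getLast? ∧ h * g * h⁻¹ = mk l := by
  have hl : g.toWord ≠ [] := fun h => hg (toWord_eq_nil_iff.1 h)
  have hr : IsReduced g.toWord := isReduced_toWord
  have hconj : ∀ e : Bool, (true, !e) ∉ g.toWord.head? → (true, e) ∉ g.toWord.getLast? →
      ∃ (h : FreeGroup Bool) (l : List (Bool × Bool)), IsReduced l ∧ l ≠ [] ∧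
      (false, false) ∉ l.head? ∧ (false, true) ∉ l.getLast? ∧ h * g * h⁻¹ = mk l := by
    intro e h1 h2
    refine ⟨mk [(true, e)], [(true, e)] ++ (g.toWord ++ [(true, !e)]), ?_, by simp, by simp,
      by simp [List.getLast?_cons], ?_⟩
    · rw [isReduced_append, isReduced_append]
      refine ⟨.singleton, ⟨hr, .singleton, ?_⟩, ?_⟩
      · rintro ⟨x, d⟩ hx y hy
        simp only [List.head?_cons, Option.mem_def, Option.some.injEq] at hy
        subst hy
        rintro rfl
        by_contra hd
        obtain rfl : d = e := by revert hd; cases d <;> cases e <;> simp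
        exact h2 hx
      · rintro x hx ⟨y, d⟩ hy
        simp only [List.getLast?_singleton, Option.mem_def, Option.some.injEq] at hx
        subst hx
        rintro rfl
        by_contra hd
        obtain rfl : d = !e := by revert hd; cases d <;> cases e <;> simp
        rw [List.head?_append_of_ne_nil _ hl] at hy
        exact h1 hy
    · rw [← mul_mk, ← mul_mk, mk_toWord, inv_mk, mul_assoc]
      rfl
  by_cases h : (false, false) ∉ g.toWord.head? ∧ (false, true) ∉ g.toWord.getLast?
  · exact ⟨1, g.toWord, hr, hl, h.1, h.2, by simp [mk_toWord]⟩
  by_cases h' : (true, false) ∉ g.toWord.head? ∧ (true, true) ∉ g.toWord.getLast?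
  · exact hconj true h'.1 h'.2
  obtain ⟨x, hx⟩ : ∃ x, g.toWord.head? = some x := by
    rw [← Option.isSome_iff_exists]; simpa using hl
  obtain ⟨y, hy⟩ : ∃ y, g.toWord.getLast? = some y := by
    rw [← Option.isSome_iff_exists]; simpa using hl
  refine hconj false ?_ ?_ <;> rw [hx, hy] at h h' <;> simp only [hx, hy] <;>
    revert h h' <;> revert x y <;> simp

/-- Successive pumping of the syllables `a ^ (N + 1)` of a block word to distinct large exponents;
the list `ms` holds the exponents that are already in place. -/
theorem exists_blockWord_mem {R : Set (FreeGroup Bool)} {N : ℕ}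
    (hN : ∀ (U V : List (Bool × Bool)) (c : Bool × Bool),
      FreeGroup.IsReduced (U ++ (List.replicate N c ++ V)) →
      FreeGroup.mk (U ++ (List.replicate N c ++ V)) ∈ R →
      ∃ p, 0 < p ∧ ∀ j, FreeGroup.mk (U ++ (List.replicate (N + p * j) c ++ V)) ∈ R)
    {V : List (Bool × Bool)} (hV : FreeGroup.IsReduced V) (hV' : (false, false) ∉ V.head?)
    (n : ℕ) (ms : List ℕ) (hms : ms.Nodup) (hmsV : ∀ k ∈ ms, V.length ≤ k)
    (hmem : FreeGroup.mk (blockWord (ms ++ List.replicate n N) ++ V) ∈ R) :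
    ∃ ks : List ℕ, ks.length = ms.length + n ∧ ks.Nodup ∧ (∀ k ∈ ks, V.length ≤ k) ∧
      FreeGroup.mk (blockWord ks ++ V) ∈ R := by
  induction n generalizing ms with
  | zero => exact ⟨ms, rfl, hms, hmsV, by simpa using hmem⟩
  | succ n ih =>
    have hred := isReduced_blockWord_append hV hV' (ms ++ List.replicate (n + 1) N)
    rw [List.replicate_succ, blockWord_append, List.append_assoc,
      blockWord_cons_append_eq] at hmem hred
    obtain ⟨p, hp, hpump⟩ := hN _ _ _ hred hmem
    -- With this `j` the new exponent exceeds all members of `ms` and the length of `V`.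
    set j := V.length + ms.sum + 1 with hj
    have hlt : j ≤ N + p * j := (Nat.le_mul_of_pos_left j hp).trans (Nat.le_add_left _ _)
    have := hpump j
    rw [← blockWord_cons_append_eq, ← List.append_assoc, ← blockWord_append] at this
    have hnd : (ms ++ [N + p * j]).Nodup := by
      rw [List.nodup_append]
      refine ⟨hms, by simp, fun k hk m hm => ?_⟩
      have := List.le_sum_of_mem hk
      simp only [List.mem_singleton] at hm
      omega
    have hge : ∀ k ∈ ms ++ [N + p * j], V.length ≤ k := by
      intro k hk
      rcases List.mem_append.1 hk with hk | hk
      · exact hmsV k hk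
      · simp only [List.mem_singleton] at hk
        omega
    obtain ⟨ks, hks, h⟩ := ih (ms ++ [N + p * j]) hnd hge (by simpa using this)
    refine ⟨ks, ?_, h⟩
    rw [hks, List.length_append, List.length_singleton]
    omega

/-- A conjugation-invariant rational subset that contains a nontrivial element has elements with
arbitrarily many distinct syllables of signed count `1`. -/
theorem IsRationalSubset.exists_signedCount_eq_one {R : Set (FreeGroup Bool)}
    (hR : IsRationalSubset R) (hconj : ∀ g ∈ R, ∀ h, h * g * h⁻¹ ∈ R)
    {g : FreeGroup Bool} (hg : g ∈ R) (hg1 : g ≠ 1) (K : ℕ) :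
    ∃ x ∈ R, ∃ T : Finset ℕ, T.card = K ∧ ∀ k ∈ T, signedCount x.toWord k = 1 := by
  obtain ⟨N, hN⟩ := hR.exists_pump
  obtain ⟨h, l, hl, hl0, hhead, hlast, hgl⟩ := FreeGroup.exists_conj_ends hg1
  set B := blockWord (List.replicate K N) with hB
  set V := l ++ FreeGroup.invRev B with hVdef
  have hV : FreeGroup.IsReduced V := by
    have : FreeGroup.IsReduced (B ++ FreeGroup.invRev l) := by
      refine isReduced_blockWord_append hl.invRev ?_ _
      rw [FreeGroup.head?_invRev, Option.mem_def, Option.map_eq_some_iff]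
      rintro ⟨⟨x, e⟩, hx, hxe⟩
      simp only [Prod.mk.injEq, Bool.not_eq_false'] at hxe
      obtain ⟨rfl, rfl⟩ := hxe
      exact hlast hx
    have h := this.invRev
    rwa [FreeGroup.invRev_append, FreeGroup.invRev_invRev] at h
  have hV' : (false, false) ∉ V.head? := by
    rwa [hVdef, List.head?_append_of_ne_nil _ hl0]
  have hmem : FreeGroup.mk (blockWord ([] ++ List.replicate K N) ++ V) ∈ R := by
    have := hconj _ (hconj g hg h) (FreeGroup.mk B)
    rwa [hgl, FreeGroup.inv_mk, FreeGroup.mul_mk, FreeGroup.mul_mk, List.append_assoc] at this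
  obtain ⟨ks, hks, hnd, hksV, hx⟩ :=
    exists_blockWord_mem hN hV hV' K [] List.nodup_nil (by simp) hmem
  refine ⟨_, hx, ks.toFinset, by rw [List.toFinset_card_of_nodup hnd, hks]; simp, fun k hk => ?_⟩
  have hk' := List.mem_toFinset.1 hk
  rw [FreeGroup.toWord_mk, (isReduced_blockWord_append hV hV' ks).reduce_eq,
    signedCount_blockWord_append ks V (hksV k hk'), List.count_eq_one_of_mem hnd hk', Nat.cast_one]

/-! ### Verbal sets -/

section Verbal

variable {G : Type*} {H : Type*} [Group G] [Group H]

theorem GroupWord.map_value (f : G →* H) (w : GroupWord) (g : ℕ → G) :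
    f (w.value g) = w.value fun i => f (g i) := by
  have : f.comp (FreeGroup.lift g) = FreeGroup.lift fun i => f (g i) := by
    ext i
    simp
  exact DFunLike.congr_fun this w

theorem GroupWord.value_of (w : GroupWord) : w.value FreeGroup.of = w :=
  (FreeGroup.lift_unique (MonoidHom.id _) fun _ => rfl).symm

theorem image_verbalSet {f : G →* H} (hf : Function.Surjective f) (w : GroupWord) :
    f '' verbalSet w G = verbalSet w H := by
  ext x
  constructor
  · rintro ⟨_, ⟨g, rfl⟩, rfl⟩
    exact ⟨fun i => f (g i), (w.map_value f g).symm⟩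
  · rintro ⟨h, rfl⟩
    choose g hg using fun i => hf (h i)
    exact ⟨_, ⟨g, rfl⟩, by simp only [w.map_value, hg]⟩

theorem conj_mem_verbalSet {w : GroupWord} {x : G} (hx : x ∈ verbalSet w G) (h : G) :
    h * x * h⁻¹ ∈ verbalSet w G := by
  obtain ⟨g, rfl⟩ := hx
  exact ⟨fun i => MulAut.conj h (g i), (w.map_value (MulAut.conj h).toMonoidHom g).symm⟩

theorem verbalSet_one : verbalSet 1 G = {1} := by
  ext x
  simp [verbalSet, GroupWord.value]

/-- By Bézout the value `1` is attained in `ℤ`; its image under `1 ↦ x` is `x`. -/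
theorem verbalSet_eq_univ {w : GroupWord} (hw : w.e = 1) : verbalSet w G = Set.univ := by
  obtain ⟨c, hc⟩ : ∃ c : ℕ → ℤ, w.value (fun i => Multiplicative.ofAdd (c i)) =
      Multiplicative.ofAdd 1 := by
    let f : (ℕ → ℤ) →+ ℤ :=
      { toFun := fun c => (w.value fun i => Multiplicative.ofAdd (c i)).toAdd
        map_zero' := by simp [w.value_eq_prod]
        map_add' := fun c d => by simp [w.value_eq_prod, mul_add, Finset.sum_add_distrib] }
    obtain ⟨d, hd⟩ := Int.subgroup_cyclic f.range
    rw [← AddSubgroup.zmultiples_eq_closure] at hd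
    have hdvd : d.natAbs ∣ w.e := by
      refine Finset.dvd_gcd fun i _ => Int.natAbs_dvd_natAbs.2 (Int.mem_zmultiples_iff.1 ?_)
      rw [← hd]
      exact ⟨fun j => if j = i then 1 else 0, rfl⟩
    rw [hw, Nat.dvd_one] at hdvd
    obtain ⟨c, hc⟩ : (1 : ℤ) ∈ f.range :=
      hd ▸ Int.mem_zmultiples_iff.2 (isUnit_iff_dvd_one.1 (Int.isUnit_iff_natAbs_eq.2 hdvd))
    exact ⟨c, congrArg Multiplicative.ofAdd hc⟩
  refine Set.eq_univ_of_forall fun x => ⟨fun i => zpowersHom G x (Multiplicative.ofAdd (c i)), ?_⟩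
  simp only
  rw [← w.map_value, hc]
  simp

end Verbal

/-! ### Reduction to rank two -/

theorem IsRationalSubset.image {M N : Type*} [Monoid M] [Monoid N] (f : M →* N) {R : Set M}
    (hR : IsRationalSubset R) : IsRationalSubset (f '' R) := by
  induction hR with
  | finite L hL => exact .finite _ (hL.image f)
  | union L₁ L₂ _ _ h₁ h₂ => rw [Set.image_union]; exact .union _ _ h₁ h₂
  | mul L₁ L₂ _ _ h₁ h₂ => rw [Set.image_mul]; exact .mul _ _ h₁ h₂
  | star L _ h =>
    rw [← Submonoid.coe_map, MonoidHom.map_mclosure]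
    exact .star _ h

/-- The conjugates `a ^ i * b * a ^ (-i)` freely generate a free group. This is seen by mapping `b`
to a generator of `FreeGroup ℤ` and `a` to the shift in `FreeGroup ℤ ⋊ ℤ`. -/
theorem exists_ne_one_mem_verbalSet {w : GroupWord} (hw : w ≠ 1) :
    ∃ x ∈ verbalSet w (FreeGroup Bool), x ≠ 1 := by
  let φ : Multiplicative ℤ →* MulAut (FreeGroup ℤ) :=
    zpowersHom _ (FreeGroup.freeGroupCongr (Equiv.addRight (1 : ℤ)))
  let f : FreeGroup Bool →* FreeGroup ℤ ⋊[φ] Multiplicative ℤ :=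
    FreeGroup.lift fun c => if c then SemidirectProduct.inr (Multiplicative.ofAdd 1)
      else SemidirectProduct.inl (FreeGroup.of 0)
  let g : ℕ → FreeGroup Bool := fun i =>
    FreeGroup.of true ^ i * FreeGroup.of false * (FreeGroup.of true ^ i)⁻¹
  have hφ : ∀ i : ℕ, φ (Multiplicative.ofAdd 1 ^ i) (FreeGroup.of 0) = FreeGroup.of (i : ℤ) := by
    intro i
    induction i with
    | zero => simp
    | succ i ih =>
      rw [pow_succ', map_mul, MulAut.mul_apply, ih]
      simp [φ]
  have hfg : ∀ i, f (g i) = SemidirectProduct.inl (FreeGroup.map (Nat.cast : ℕ → ℤ) (.of i)) := by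
    intro i
    rw [FreeGroup.map.of, ← hφ, SemidirectProduct.inl_aut]
    simp [f, g]
  refine ⟨w.value g, ⟨g, rfl⟩, fun h => hw ?_⟩
  have h1 : f (w.value g) = 1 := by rw [h, map_one]
  simp only [w.map_value, hfg] at h1
  rw [← w.map_value SemidirectProduct.inl, ← w.map_value (FreeGroup.map (Nat.cast : ℕ → ℤ)),
    w.value_of] at h1
  refine FreeGroup.map_injective Nat.cast_injective (SemidirectProduct.inl_injective (φ := φ) ?_)
  rw [h1, map_one, map_one]

/-! ### Proper words -/

theorem GroupWord.isProper_iff (w : GroupWord) :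
    GroupWord.IsProper.{v} w ↔ w.e ≠ 1 ∧ w ≠ 1 := by
  constructor
  · rintro ⟨⟨G, _, hG⟩, H, _, hH⟩
    refine ⟨fun h => hH (verbalSet_eq_univ h), ?_⟩
    rintro rfl
    exact hG verbalSet_one
  · rintro ⟨he, hw⟩
    refine ⟨⟨ULift.{v} GroupWord, inferInstance, fun h => hw ?_⟩,
      ULift.{v} (Multiplicative ℤ), inferInstance, fun h => he ?_⟩
    · have : w.value (fun i => MulEquiv.ulift.symm (FreeGroup.of i)) = 1 := by
        have h' := Set.mem_range_self (f := fun g : ℕ → ULift.{v} GroupWord => w.value g)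
          fun i => MulEquiv.ulift.symm (FreeGroup.of i)
        exact h.subset h'
      have h' := congrArg (MulEquiv.ulift.toMonoidHom) this
      rw [w.map_value, map_one] at h'
      exact w.value_of ▸ h'
    · obtain ⟨g, hg⟩ : ULift.up (Multiplicative.ofAdd 1) ∈
          verbalSet w (ULift.{v} (Multiplicative ℤ)) :=
        h ▸ Set.mem_univ _
      obtain ⟨x, hx⟩ := w.exists_value_eq_pow g
      have h1 : (1 : ℤ) = w.e * (MulEquiv.ulift x).toAdd := by
        have := congrArg (fun y => (MulEquiv.ulift y).toAdd) (hg.symm.trans hx)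
        simp only [map_pow, toAdd_pow, nsmul_eq_mul] at this
        exact this
      exact Nat.dvd_one.1 (Int.natCast_dvd_natCast.1 ⟨_, h1⟩)

/-! ### Non-rationality of verbal sets of proper words -/

/-- A free group on at least two generators retracts onto a free group of rank two. -/
theorem exists_surjective_freeGroup_bool {F : Type u} [Group F] [IsFreeGroup F]
    (hF : ∃ a b : F, a * b ≠ b * a) :
    ∃ f : F →* FreeGroup Bool, Function.Surjective f := by
  classical
  have e := IsFreeGroup.mulEquiv F
  have : Nontrivial (IsFreeGroup.Generators F) := by
    by_contra h
    rw [not_nontrivial_iff_subsingleton] at h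
    obtain ⟨a, b, hab⟩ := hF
    have hcomm : ∀ x y : FreeGroup (IsFreeGroup.Generators F), x * y = y * x := by
      rcases isEmpty_or_nonempty (IsFreeGroup.Generators F) with _ | ⟨⟨x⟩⟩
      · exact fun _ _ => Subsingleton.elim _ _
      · have : Unique (IsFreeGroup.Generators F) := uniqueOfSubsingleton x
        intro x y
        apply FreeGroup.mulEquivIntOfUnique.injective
        rw [map_mul, map_mul, mul_comm]
    apply hab
    apply e.symm.injective
    rw [map_mul, map_mul, hcomm]
  obtain ⟨x, y, hxy⟩ := exists_pair_ne (IsFreeGroup.Generators F)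
  let f : FreeGroup (IsFreeGroup.Generators F) →* FreeGroup Bool :=
    FreeGroup.lift fun z => FreeGroup.of (decide (z = x))
  have hf : f.comp (FreeGroup.lift fun c => if c then .of x else .of y) = MonoidHom.id _ := by
    ext c
    cases c <;> simp [f, hxy.symm]
  refine ⟨f.comp e.symm.toMonoidHom, ?_⟩
  rw [MonoidHom.coe_comp]
  refine Function.Surjective.comp (fun z => ⟨_, DFunLike.congr_fun hf z⟩) e.symm.surjective

theorem not_isRationalSubset_verbalSet_freeGroup_bool {w : GroupWord} (he : w.e ≠ 1)
    (hw : w ≠ 1) : ¬ IsRationalSubset (verbalSet w (FreeGroup Bool)) := by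
  intro hR
  obtain ⟨x, hx, hx1⟩ := exists_ne_one_mem_verbalSet hw
  obtain ⟨C, hC⟩ := exists_card_forall_e_dvd_signedCount w
  obtain ⟨y, hy, T, hT, hTy⟩ :=
    hR.exists_signedCount_eq_one (fun _ h => conj_mem_verbalSet h) hx hx1 (C + 1)
  obtain ⟨S, hS, hSy⟩ := hC y hy
  obtain ⟨k, hkT, hkS⟩ := Finset.exists_mem_notMem_of_card_lt_card (s := S) (t := T) (by omega)
  have := hSy k hkS
  rw [hTy k hkT] at this
  exact he (by exact_mod_cast Int.natCast_dvd.1 this |> Nat.dvd_one.1)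

theorem theorem5p6 {F : Type u} [Group F] [IsFreeGroup F]
    (hF : ∃ a b : F, a * b ≠ b * a) (w : GroupWord) :
    (GroupWord.IsProper.{v} w ↔ GroupWord.e w ≠ 1 ∧ w ≠ 1) ∧
    (GroupWord.IsProper.{v} w → ¬ IsRationalSubset (verbalSet w F)) ∧
    (IsRationalSubset (verbalSet w F) →
      verbalSet w F = {1} ∨ verbalSet w F = Set.univ) := by
  have key : w.e ≠ 1 → w ≠ 1 → ¬ IsRationalSubset (verbalSet w F) := by
    intro he hw hR
    obtain ⟨f, hf⟩ := exists_surjective_freeGroup_bool hF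
    have := hR.image f
    rw [image_verbalSet hf] at this
    exact not_isRationalSubset_verbalSet_freeGroup_bool he hw this
  refine ⟨w.isProper_iff, fun h => key (w.isProper_iff.1 h).1 (w.isProper_iff.1 h).2, fun hR => ?_⟩
  by_cases hw : w = 1
  · exact Or.inl (hw ▸ verbalSet_one)
  · exact Or.inr (verbalSet_eq_univ (by_contra fun he => key he hw hR))
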